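/- **Setting.** $N\ge 1$ agents are the vertices of an undirected graph $G$; agent $i$ has a continuously differentiable $f_i:\mathbb R^K\to\mathbb R$. Put $f=\frac1N\sum_i f_i$, and write $\bar{\mathbf x}=\frac1N\sum_i \mathbf x_i$ for $\mathbf x=(\mathbf x_1,\dots,\mathbf x_N)$; $\|\cdot\|$ is the $\ell_2$ norm. *Problem.* For each compact $X\subset\mathbb R^K$ and each $i$ there is a finite constant $L_i(X)\ge 1$, monotone in $X$, with $\|\nabla f_i(\mathbf y)-\nabla f_i(\mathbf z)\|\le L_i(X)\|\mathbf y-\mathbf z\|$ for $\mathbf y,\mathbf z\in X$; and $f(\mathbf u)>\underline f$ for all $\mathbf u$. *Weights.* $\mathbf W\in\mathbb R^{N\times N}$ is symmetric, $\mathrm{Null}(\mathbf I-\mathbf W)=\mathrm{span}\{\mathbf 1\}$, $-\mathbf I\preceq\mathbf W\preceq\mathbf I$, $W_{ij}>0$ if $i,j$ are neighbors, $W_{ij}=0$ if $i\ne j$ are not neighbors, $W_{ii}\ge 0$, and $\eta:=\|\mathbf W-\frac1N\mathbf 1\mathbf 1^T\|<1$ (spectral norm; this is the second largest absolute value of an eigenvalue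 of $\mathbf W$). *MAGENTA.* Let $\mathbf x(0)$ be the initial point, $\mathbf y_i(0)=\nabla f_i(\mathbf x_i(0))$, $\mathbf z=\bar{\mathbf x}(0)$, let $0\le v^0\le v^1\le v^2\le\cdots$ be radii, $X(t)=\{\mathbf u:\|\mathbf u-\mathbf z\|\le v^t\}$, with $\mathbf x_i(0)\in X(1)$ for all $i$. Let $\hat L(t)=\max_i L_i(X(t))$, $\gamma,\xi>0$ with $(1+\gamma)\eta^2<1$ and $(1+\xi)\eta^2<1$, $\beta=\frac12$, and $$\alpha(t)=\min\left\{\frac1{8N}\cdot\frac1{\hat L(t)/(2N)+1/\gamma+5/4},\ \frac{N(1-(1+\gamma)\eta^2)(1-(1+\xi)\eta^2)}{64(1+1/\xi)\hat L^2(t)},\ 1\right\}.$$ Stage $t=1,2,\dots$ starts at the final point of stage $t-1$ (stage 1 at $(\mathbf x(0),\mathbf y(0))$) and makes $R(t)=\lceil 1/(\epsilon\alpha(t))\rceil$ inner iterations $$\widetilde{\mathbf x}_i^{r+1}=\arg\min_{\mathbf u\in X(t)}\langle \mathbf y_i^r,\mathbf u-\mathbf x_i^r\rangle+\tfrac1{2\alpha(t)}\|\mathbf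 u-\mathbf x_i^r\|^2,\quad \mathbf x_i^{r+1}=\sum_j W_{ij}\bigl(\mathbf x_j^r+\beta(\widetilde{\mathbf x}_j^{r+1}-\mathbf x_j^r)\bigr),\quad \mathbf y_i^{r+1}=\sum_j W_{ij}\mathbf y_j^r+\nabla f_i(\mathbf x_i^{r+1})-\nabla f_i(\mathbf x_i^r).$$ Each inner iteration is one round of local gradient computation and of message exchange among neighbors. With the iterates of stage $t$ put $$\text{avg-gap}(t)=\frac1{R(t)}\sum_{r=0}^{R(t)-1}\left(\|\mathbf y^r\|^2+\|\mathbf x^r-\mathbf 1\bar{\mathbf x}^r\|^2+\|\mathbf y^r-\mathbf 1\bar{\mathbf y}^r\|^2\right),$$ and let $$P_0=f(\bar{\mathbf x}(0))+\|\mathbf x(0)-\mathbf 1\bar{\mathbf x}(0)\|^2+\frac{1-(1+\gamma)\eta^2}{32(1+1/\xi)\hat L^2(1)}\|\mathbf y(0)-\mathbf 1\bar{\mathbf y}(0)\|^2 .$$ **Theorem.** Let $0<\epsilon<2(1-(1+\gamma)\eta^2)$ and let the integer $T^*>0$ satisfy $$T^*=\left\lceil\frac1\epsilon\cdot\frac{128(P_0-\underline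 f)}{\frac1{T^*}\sum_{t=1}^{T^*}(v^t-v^{t-1})^2}\right\rceil .$$ Then there is a stage $t\in\{1,\dots,T^*\}$ that is $\mathcal O(\epsilon)$-stationary for the unconstrained problem: $\text{avg-gap}(t)\le C\,(P_0-\underline f)\,\epsilon$ with $$C=\max\left\{32N,\ \frac4{1-(1+\gamma)\eta^2},\ \frac{32N(1+1/\xi)}{1-(1+\xi)\eta^2}\right\}.$$ The number of rounds of local gradient computation and message exchange made in the stages $1,\dots,T^*$ is $\sum_{t=1}^{T^*}\lceil 1/(\epsilon\alpha(t))\rceil$. It lies in $[S,S+T^*)$, and equals $S$ if all $1/(\epsilon\alpha(t))$, $1\le t\le T^*$, are integers, where $$S=\frac1\epsilon\sum_{t=1}^{T^*}\frac1{\alpha(t)}=\frac1\epsilon\sum_{t=1}^{T^*}\max\left\{4\hat L(t)+\frac{8N}\gamma+10N,\ \frac{64(1+1/\xi)\hat L^2(t)}{N(1-(1+\gamma)\eta^2)(1-(1+\xi)\eta^2)},\ 1\right\}.$$ -/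

import Mathlib

noncomputable section

namespace Magenta

/-- The space `ℝ^K` with its Euclidean norm. -/
abbrev Vec (K : ℕ) := EuclideanSpace ℝ (Fin K)

/-- The average `(1/N) ∑ i, x i` of the agents' vectors. -/
def average {N K : ℕ} (x : Fin N → Vec K) : Vec K :=
  (1 / (N : ℝ)) • ∑ i, x i

/-- Squared `ℓ²` norm of the stacked vector `(x 1; …; x N)` of `ℝ^{NK}`. -/
def stackedSq {N K : ℕ} (x : Fin N → Vec K) : ℝ :=
  ∑ i, ‖x i‖ ^ 2

/-- Squared consensus error `‖x - 1 x̄‖²`. -/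
def consensusSq {N K : ℕ} (x : Fin N → Vec K) : ℝ :=
  stackedSq fun i => x i - average x

/-- The average objective `f(u) = (1/N) ∑ i, f_i(u)`. -/
def avgFun {N K : ℕ} (f : Fin N → Vec K → ℝ) (u : Vec K) : ℝ :=
  (1 / (N : ℝ)) * ∑ i, f i u

/-- Assumptions on the problem. `Lip i X` is the constant `L_i(X)` attached to the compact
set `X`. -/
structure ProblemAssumption {N K : ℕ} (f : Fin N → Vec K → ℝ)
    (Lip : Fin N → Set (Vec K) → ℝ) (fLow : ℝ) : Prop where
  contDiff : ∀ i, ContDiff ℝ 1 (f i)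
  lipschitz : ∀ i, ∀ X : Set (Vec K), IsCompact X → ∀ y ∈ X, ∀ z ∈ X,
    ‖gradient (f i) y - gradient (f i) z‖ ≤ Lip i X * ‖y - z‖
  one_le : ∀ i, ∀ X : Set (Vec K), IsCompact X → 1 ≤ Lip i X
  mono : ∀ i, ∀ X₁ X₂ : Set (Vec K), IsCompact X₁ → IsCompact X₂ → X₁ ⊆ X₂ →
    Lip i X₁ ≤ Lip i X₂
  lower : ∀ u, fLow < avgFun f u

/-- The operator norm `η` of `W - (1/N) 1 1ᵀ`. For a mixing matrix this is the second largest
absolute value of an eigenvalue of `W`. -/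
def mixingRate {N : ℕ} (W : Matrix (Fin N) (Fin N) ℝ) : ℝ :=
  ‖Matrix.toEuclideanCLM (n := Fin N) (𝕜 := ℝ) (W - Matrix.of fun _ _ => 1 / (N : ℝ))‖

/-- Assumptions on the weight matrix `W` of the communication graph `G`. -/
structure WeightAssumption {N : ℕ} (G : SimpleGraph (Fin N))
    (W : Matrix (Fin N) (Fin N) ℝ) : Prop where
  symm : W.IsSymm
  ker : LinearMap.ker (Matrix.mulVecLin (1 - W)) = Submodule.span ℝ {(1 : Fin N → ℝ)}
  neg_one_le : (1 + W).PosSemidef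
  le_one : (1 - W).PosSemidef
  eq_zero : ∀ i j, i ≠ j → ¬ G.Adj i j → W i j = 0
  pos : ∀ i j, G.Adj i j → 0 < W i j
  diag_nonneg : ∀ i, 0 ≤ W i i
  mixingRate_lt_one : mixingRate W < 1

/-- The data on which MAGENTA runs: local functions, Lipschitz constants on compact sets,
weight matrix, initial point, radii of the stages, the parameters `γ`, `ξ`, and the accuracy. -/
structure Input (N K : ℕ) where
  f : Fin N → Vec K → ℝ
  Lip : Fin N → Set (Vec K) → ℝ
  W : Matrix (Fin N) (Fin N) ℝ
  x₀ : Fin N → Vec K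
  v : ℕ → ℝ
  γ : ℝ
  ξ : ℝ
  ε : ℝ

/-- State of all agents, with the number of rounds made so far. In one round every agent exchanges
messages with its neighbours once and computes one new local gradient. -/
structure State (N K : ℕ) where
  x : Fin N → Vec K
  y : Fin N → Vec K
  rounds : ℕ

open Classical in
/-- The minimizer over `p ∈ X` of `⟪y, p - x⟫ + ‖p - x‖² / (2α)`. -/
def proxStep {K : ℕ} (X : Set (Vec K)) (α : ℝ) (y x : Vec K) : Vec K :=
  if h : ∃ p ∈ X, IsMinOn (fun q => inner ℝ y (q - x) + 1 / (2 * α) * ‖q - x‖ ^ 2) X p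
  then h.choose else x

/-- One inner iteration with feasible set `X` and stepsizes `α`, `β`. Since `W i j = 0` when `j`
is neither `i` nor a neighbour of `i`, the sums over all `j` only use messages of neighbours. -/
def innerStep {N K : ℕ} (f : Fin N → Vec K → ℝ) (W : Matrix (Fin N) (Fin N) ℝ)
    (X : Set (Vec K)) (α β : ℝ) (s : State N K) : State N K :=
  let xt : Fin N → Vec K := fun i => proxStep X α (s.y i) (s.x i)
  let v : Fin N → Vec K := fun i => xt i - s.x i
  let x' : Fin N → Vec K := fun i => ∑ j, W i j • (s.x j + β • v j)
  { x := x'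
    y := fun i => (∑ j, W i j • s.y j) + gradient (f i) (x' i) - gradient (f i) (s.x i)
    rounds := s.rounds + 1 }

namespace Input

variable {N K : ℕ} (M : Input N K)

/-- The contraction factor of the weight matrix. -/
def η : ℝ := mixingRate M.W

/-- The feasible set `X(t)`: closed ball of radius `v^t` around the average initial point. -/
def X (t : ℕ) : Set (Vec K) := Metric.closedBall (average M.x₀) (M.v t)

/-- `L̂(t) = max_i L_i(X(t))`. -/
def Lhat (t : ℕ) : ℝ := ⨆ i, M.Lip i (M.X t)

/-- The stepsize `α(t)`. -/
def α (t : ℕ) : ℝ :=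
  min (min (1 / (8 * (N : ℝ)) * (1 / (M.Lhat t / (2 * N) + (1 / M.γ + 5 / 4))))
    (N * (1 - (1 + M.γ) * M.η ^ 2) * (1 - (1 + M.ξ) * M.η ^ 2)
      / (64 * (1 + 1 / M.ξ) * M.Lhat t ^ 2))) 1

/-- Number of inner iterations of stage `t`: `1/(ε α(t))`, rounded up to an integer. -/
def R (t : ℕ) : ℕ := ⌈1 / (M.ε * M.α t)⌉₊

/-- The initial gradients `y_i = ∇f_i(x_i)`. -/
def y₀ (i : Fin N) : Vec K := gradient (M.f i) (M.x₀ i)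

/-- One inner iteration of stage `t`, with `β = 1/2`. -/
def stageStep (t : ℕ) : State N K → State N K :=
  innerStep M.f M.W (M.X t) (M.α t) (1 / 2)

/-- The state after the stages `1, …, T`. -/
def afterStages : ℕ → State N K
  | 0 => { x := M.x₀, y := M.y₀, rounds := 0 }
  | t + 1 => (M.stageStep (t + 1))^[M.R (t + 1)] (afterStages t)

/-- The `r`-th inner iterate `(x^r, y^r)` of stage `t ≥ 1`. -/
def iter (t r : ℕ) : State N K := (M.stageStep t)^[r] (M.afterStages (t - 1))

/-- The stationarity gap of stage `t` for the unconstrained problem. -/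
def avgGap (t : ℕ) : ℝ :=
  1 / (M.R t : ℝ) * ∑ r ∈ Finset.range (M.R t),
    (stackedSq (M.iter t r).y + consensusSq (M.iter t r).x + consensusSq (M.iter t r).y)

/-- The potential function `P(w; t)` at `w = (x, y, x̄, ȳ)`. -/
def potential (x y : Fin N → Vec K) (t : ℕ) : ℝ :=
  avgFun M.f (average x) + consensusSq x
    + (1 - (1 + M.γ) * M.η ^ 2) / (32 * (1 + 1 / M.ξ) * M.Lhat t ^ 2) * consensusSq y

/-- The value `P(w⁰; 1)` of the potential at the start of the first stage. -/
def initialPotential : ℝ := M.potential M.x₀ M.y₀ 1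

/-- The equation for the number of stages. -/
def IsStageNumber (fLow : ℝ) (T : ℕ) : Prop :=
  0 < T ∧
    T = ⌈1 / M.ε * (128 * (M.initialPotential - fLow)
      / (1 / (T : ℝ) * ∑ t ∈ Finset.Icc 1 T, (M.v t - M.v (t - 1)) ^ 2))⌉₊

/-- The constant in front of `(P(w⁰; 1) - fLow) ε` in the stationarity bound. -/
def gapConst : ℝ :=
  max (max (32 * (N : ℝ)) (4 / (1 - (1 + M.γ) * M.η ^ 2)))
    (32 * N * (1 + 1 / M.ξ) / (1 - (1 + M.ξ) * M.η ^ 2))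

end Input

end Magenta

end

/-! The potential is the mean objective at the average point, plus the consensus error of `x`, plus
a weighted tracking error of `y`. Each inner iteration lowers it by at least `decrease`, a positive
combination of the squared displacements and both consensus errors (`potential_innerStep_le`).
Passing to the next stage does not raise it (`potential_succ_le`). Hence the decreases of all stages
sum to less than `initialPotential - fLow`.

Each stage falls under one of two cases. If every proximal point is interior to `X t`, the proximal
step is a plain gradient step, so the displacement is `-α y` and the decrease dominates the gap;
averaging over at least `1 / (ε α)` iterations gives the bound (`avgGap_le_of_interior`). If some
proximal point reaches the boundary, the agents have crossed the shell between the radii `v (t - 1)`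
and `v t`, which costs at least `ε / 12` times its squared width (`le_sum_decrease_of_boundary`).
The equation for `T` makes the squared widths so large that not all stages can be of the second
kind. -/

namespace Magenta

/-! ### Young inequalities and the descent lemma. -/

theorem norm_sum_sq_le {ι E : Type*} [NormedAddCommGroup E] (s : Finset ι) (u : ι → E) :
    ‖∑ i ∈ s, u i‖ ^ 2 ≤ s.card * ∑ i ∈ s, ‖u i‖ ^ 2 :=
  (pow_le_pow_left₀ (norm_nonneg _) (norm_sum_le s u) 2).trans sq_sum_le_card_mul_sum_sq

theorem norm_add_sq_le_young {E : Type*} [NormedAddCommGroup E] [InnerProductSpace ℝ E]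
    {a : ℝ} (ha : 0 < a) (u v : E) :
    ‖u + v‖ ^ 2 ≤ (1 + a) * ‖u‖ ^ 2 + (1 + 1 / a) * ‖v‖ ^ 2 := by
  have h1 : ‖u + v‖ ^ 2 ≤ (‖u‖ + ‖v‖) ^ 2 :=
    pow_le_pow_left₀ (norm_nonneg _) (norm_add_le u v) 2
  have h2 : (1 + a) * ‖u‖ ^ 2 + (1 + 1 / a) * ‖v‖ ^ 2 - (‖u‖ + ‖v‖) ^ 2
      = (a * ‖u‖ - ‖v‖) ^ 2 / a := by
    field_simp
    ring
  have h3 : 0 ≤ (a * ‖u‖ - ‖v‖) ^ 2 / a := by positivity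
  linarith

theorem inner_le_young {E : Type*} [NormedAddCommGroup E] [InnerProductSpace ℝ E]
    {a : ℝ} (ha : 0 < a) (u v : E) :
    inner ℝ u v ≤ a / 2 * ‖u‖ ^ 2 + 1 / (2 * a) * ‖v‖ ^ 2 := by
  have h1 := real_inner_le_norm u v
  have h2 : a / 2 * ‖u‖ ^ 2 + 1 / (2 * a) * ‖v‖ ^ 2 - ‖u‖ * ‖v‖
      = (a * ‖u‖ - ‖v‖) ^ 2 / (2 * a) := by
    field_simp
    ring
  have h3 : 0 ≤ (a * ‖u‖ - ‖v‖) ^ 2 / (2 * a) := by positivity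
  linarith

/-- The quadratic upper bound for a function whose gradient is Lipschitz on a convex set. -/
theorem le_add_inner_gradient {E : Type*} [NormedAddCommGroup E] [InnerProductSpace ℝ E]
    [CompleteSpace E] {f : E → ℝ} (hf : ContDiff ℝ 1 f) {X : Set E} (hX : Convex ℝ X) {L : ℝ}
    (hL : ∀ y ∈ X, ∀ z ∈ X, ‖gradient f y - gradient f z‖ ≤ L * ‖y - z‖)
    {a b : E} (ha : a ∈ X) (hb : b ∈ X) :
    f b ≤ f a + inner ℝ (gradient f a) (b - a) + L / 2 * ‖b - a‖ ^ 2 := by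
  set d := b - a with hd
  -- Along the segment, `g` is `f` minus the two nonconstant terms of its quadratic bound. The
  -- Lipschitz condition gives `g' ≤ 0`, and `g 1 ≤ g 0` is the claim.
  let g : ℝ → ℝ := fun s => f (a + s • d) - s * inner ℝ (gradient f a) d - L / 2 * ‖d‖ ^ 2 * s ^ 2
  have hg : ∀ s, HasDerivAt g
      (inner ℝ (gradient f (a + s • d)) d - inner ℝ (gradient f a) d - L * ‖d‖ ^ 2 * s) s := by
    intro s
    have h1 : HasFDerivAt f (InnerProductSpace.toDual ℝ E (gradient f (a + s • d)))
        (a + s • d) :=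
      ((hf.differentiable one_ne_zero) _).hasGradientAt.hasFDerivAt
    have h2 : HasDerivAt (fun s : ℝ => a + s • d) d s := by
      simpa using ((hasDerivAt_id s).smul_const d).const_add a
    have h3 := h1.comp_hasDerivAt s h2
    have h4 : HasDerivAt (fun s : ℝ => s * inner ℝ (gradient f a) d)
        (inner ℝ (gradient f a) d) s := by
      simpa using (hasDerivAt_id s).mul_const (inner ℝ (gradient f a) d)
    have h5 : HasDerivAt (fun s : ℝ => L / 2 * ‖d‖ ^ 2 * s ^ 2) (L * ‖d‖ ^ 2 * s) s := by
      have := (hasDerivAt_pow 2 s).const_mul (L / 2 * ‖d‖ ^ 2)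
      exact this.congr_deriv (by push_cast; ring)
    exact (h3.sub h4).sub h5
  have hanti : AntitoneOn g (Set.Icc 0 1) := by
    refine antitoneOn_of_deriv_nonpos (convex_Icc 0 1)
      (fun s _ => (hg s).continuousAt.continuousWithinAt)
      (fun s _ => (hg s).differentiableAt.differentiableWithinAt) fun s hs => ?_
    rw [interior_Icc] at hs
    rw [(hg s).deriv]
    have hmem : a + s • d ∈ X := by
      have := hX.add_smul_sub_mem ha hb ⟨hs.1.le, hs.2.le⟩
      simpa [hd] using this
    have h1 := hL _ hmem a ha
    rw [add_sub_cancel_left, norm_smul, Real.norm_of_nonneg hs.1.le] at h1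
    have h2 := real_inner_le_norm (gradient f (a + s • d) - gradient f a) d
    rw [inner_sub_left] at h2
    have h3 := mul_le_mul_of_nonneg_right h1 (norm_nonneg d)
    nlinarith
  have h := hanti (Set.left_mem_Icc.2 zero_le_one) (Set.right_mem_Icc.2 zero_le_one) zero_le_one
  simp only [g, one_smul, zero_smul, add_zero, hd, add_sub_cancel] at h
  rw [← hd] at h
  linarith

/-! ### Stacked vectors, averages and consensus errors. -/

section Stacked

variable {N K : ℕ}

theorem stackedSq_nonneg (x : Fin N → Vec K) : 0 ≤ stackedSq x :=
  Finset.sum_nonneg fun _ _ => by positivity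

theorem norm_sq_le_stackedSq (x : Fin N → Vec K) (i : Fin N) : ‖x i‖ ^ 2 ≤ stackedSq x :=
  Finset.single_le_sum (f := fun i => ‖x i‖ ^ 2) (fun _ _ => by positivity) (Finset.mem_univ i)

theorem stackedSq_smul (a : ℝ) (x : Fin N → Vec K) :
    stackedSq (fun i => a • x i) = a ^ 2 * stackedSq x := by
  simp [stackedSq, norm_smul, mul_pow, Finset.mul_sum]

theorem stackedSq_add_le {a : ℝ} (ha : 0 < a) (u v : Fin N → Vec K) :
    stackedSq (fun i => u i + v i) ≤ (1 + a) * stackedSq u + (1 + 1 / a) * stackedSq v := by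
  simp only [stackedSq, Finset.mul_sum, ← Finset.sum_add_distrib]
  exact Finset.sum_le_sum fun i _ => norm_add_sq_le_young ha _ _

theorem average_add (x y : Fin N → Vec K) :
    average (fun i => x i + y i) = average x + average y := by
  simp [average, Finset.sum_add_distrib]

theorem average_sub (x y : Fin N → Vec K) :
    average (fun i => x i - y i) = average x - average y := by
  simp [average, Finset.sum_sub_distrib, smul_sub]

theorem average_smul (a : ℝ) (x : Fin N → Vec K) :
    average (fun i => a • x i) = a • average x := by
  simp [average, ← Finset.smul_sum, smul_comm a]

theorem nat_smul_average (hN : 0 < N) (x : Fin N → Vec K) :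
    (N : ℝ) • average x = ∑ i, x i := by
  have : (N : ℝ) ≠ 0 := by positivity
  rw [average, smul_smul, mul_one_div_cancel this, one_smul]

theorem average_const (hN : 0 < N) (z : Vec K) : average (fun _ : Fin N => z) = z := by
  have : (N : ℝ) ≠ 0 := by positivity
  simp [average, ← Nat.cast_smul_eq_nsmul ℝ, smul_smul, this]

theorem average_mem (hN : 0 < N) {X : Set (Vec K)} (hX : Convex ℝ X) {x : Fin N → Vec K}
    (hx : ∀ i, x i ∈ X) : average x ∈ X := by
  have : (N : ℝ) ≠ 0 := by positivity
  rw [average, Finset.smul_sum]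
  exact hX.sum_mem (fun _ _ => by positivity) (by simp [this]) fun i _ => hx i

theorem norm_average_sq_le (hN : 0 < N) (x : Fin N → Vec K) :
    (N : ℝ) * ‖average x‖ ^ 2 ≤ stackedSq x := by
  have hN' : (0 : ℝ) < N := by positivity
  have h := norm_sum_sq_le Finset.univ x
  rw [← nat_smul_average hN, norm_smul, mul_pow, Finset.card_univ, Fintype.card_fin,
    Real.norm_of_nonneg hN'.le] at h
  change _ ≤ (N : ℝ) * stackedSq x at h
  nlinarith

theorem consensusSq_nonneg (x : Fin N → Vec K) : 0 ≤ consensusSq x := stackedSq_nonneg _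

theorem consensusSq_le_stackedSq (hN : 0 < N) (x : Fin N → Vec K) :
    consensusSq x ≤ stackedSq x := by
  -- The variance identity: subtracting the mean removes exactly `N ‖x̄‖²`.
  have h : consensusSq x = stackedSq x - N * ‖average x‖ ^ 2 := by
    have h1 : ∑ i, inner ℝ (x i) (average x) = N * ‖average x‖ ^ 2 := by
      rw [← sum_inner, ← nat_smul_average hN, real_inner_smul_left, real_inner_self_eq_norm_sq]
    simp only [consensusSq, stackedSq, norm_sub_sq_real, Finset.sum_add_distrib,
      Finset.sum_sub_distrib, ← Finset.mul_sum, h1]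
    simp
    ring
  have : 0 ≤ (N : ℝ) * ‖average x‖ ^ 2 := by positivity
  linarith

/-- `A` acts on the agents only, so for each coordinate `k` the operator norm bounds its action on
the vector of `k`-th coordinates in `ℝ^N`. -/
theorem stackedSq_mul_le (A : Matrix (Fin N) (Fin N) ℝ) (u : Fin N → Vec K) :
    stackedSq (fun i => ∑ j, A i j • u j)
      ≤ ‖Matrix.toEuclideanCLM (n := Fin N) (𝕜 := ℝ) A‖ ^ 2 * stackedSq u := by
  simp only [stackedSq, EuclideanSpace.real_norm_sq_eq]
  rw [Finset.sum_comm, Finset.sum_comm (f := fun i k => (u i).ofLp k ^ 2), Finset.mul_sum]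
  refine Finset.sum_le_sum fun k _ => ?_
  have h := (Matrix.toEuclideanCLM (n := Fin N) (𝕜 := ℝ) A).le_opNorm
    (WithLp.toLp 2 fun j => (u j).ofLp k)
  have h2 := pow_le_pow_left₀ (norm_nonneg _) h 2
  rw [mul_pow, EuclideanSpace.real_norm_sq_eq, EuclideanSpace.real_norm_sq_eq] at h2
  simpa [Matrix.mulVec, dotProduct] using h2

end Stacked

/-! ### Mixing with a doubly stochastic matrix. -/

namespace WeightAssumption

variable {N K : ℕ} {G : SimpleGraph (Fin N)} {W : Matrix (Fin N) (Fin N) ℝ}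

theorem sum_row (hW : WeightAssumption G W) (i : Fin N) : ∑ j, W i j = 1 := by
  have h : (1 : Fin N → ℝ) ∈ LinearMap.ker (Matrix.mulVecLin (1 - W)) := by
    rw [hW.ker]
    exact Submodule.mem_span_singleton_self _
  have h1 := congrFun (LinearMap.mem_ker.1 h) i
  simp [Matrix.mulVec, dotProduct] at h1
  linarith

theorem sum_col (hW : WeightAssumption G W) (j : Fin N) : ∑ i, W i j = 1 := by
  rw [← hW.sum_row j]
  exact Finset.sum_congr rfl fun i _ => hW.symm.apply j i

theorem nonneg (hW : WeightAssumption G W) (i j : Fin N) : 0 ≤ W i j := by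
  by_cases hij : i = j
  · exact hij ▸ hW.diag_nonneg i
  · by_cases hG : G.Adj i j
    · exact (hW.pos i j hG).le
    · exact (hW.eq_zero i j hij hG).ge

theorem average_mix (hW : WeightAssumption G W) (u : Fin N → Vec K) :
    average (fun i => ∑ j, W i j • u j) = average u := by
  unfold average
  rw [Finset.sum_comm]
  simp [← Finset.sum_smul, hW.sum_col]

theorem mix_const (hW : WeightAssumption G W) (z : Vec K) (i : Fin N) :
    ∑ j, W i j • z = z := by
  rw [← Finset.sum_smul, hW.sum_row, one_smul]

theorem mix_mem (hW : WeightAssumption G W) {X : Set (Vec K)} (hX : Convex ℝ X)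
    {u : Fin N → Vec K} (hu : ∀ i, u i ∈ X) (i : Fin N) : ∑ j, W i j • u j ∈ X :=
  hX.sum_mem (fun j _ => hW.nonneg i j) (hW.sum_row i) fun j _ => hu j

/-- Jensen for `‖·‖²` with the row weights; the column sums then collapse the double sum. -/
theorem stackedSq_mix_le (hW : WeightAssumption G W) (u : Fin N → Vec K) :
    stackedSq (fun i => ∑ j, W i j • u j) ≤ stackedSq u := by
  have hconv : ConvexOn ℝ Set.univ fun z : Vec K => ‖z‖ ^ 2 :=
    convexOn_univ_norm.pow (fun _ _ => norm_nonneg _) 2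
  calc stackedSq (fun i => ∑ j, W i j • u j)
      ≤ ∑ i, ∑ j, W i j * ‖u j‖ ^ 2 :=
        Finset.sum_le_sum fun i _ => by
          simpa using hconv.map_sum_le (t := Finset.univ) (w := W i) (p := u)
            (fun j _ => hW.nonneg i j) (hW.sum_row i) fun _ _ => Set.mem_univ _
    _ = stackedSq u := by
        rw [Finset.sum_comm]
        simp [← Finset.sum_mul, hW.sum_col, stackedSq]

/-- Mixing minus averaging contracts, and it does not see the average. -/
theorem stackedSq_mix_sub_average_le (hN : 0 < N) (hW : WeightAssumption G W)
    (u : Fin N → Vec K) (z : Vec K) :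
    stackedSq (fun i => (∑ j, W i j • u j) - average u)
      ≤ mixingRate W ^ 2 * stackedSq (fun i => u i - z) := by
  have h := stackedSq_mul_le (W - Matrix.of fun _ _ => 1 / (N : ℝ)) (fun i => u i - z)
  simp only [mixingRate]
  convert h using 3 with i
  have h1 : ∑ j, (1 / (N : ℝ)) • (u j - z) = average u - z := by
    rw [← Finset.smul_sum]
    exact (average_sub u fun _ => z).trans (by rw [average_const hN])
  simp only [Matrix.sub_apply, Matrix.of_apply, sub_smul, Finset.sum_sub_distrib, h1]
  simp only [smul_sub, Finset.sum_sub_distrib, hW.mix_const]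
  abel

/-- Since `W` fixes constants, the difference is `(W - I)(u - z) + W w`. Two uses of Young with `a =
1` and nonexpansiveness of `W` give 8 and 2. -/
theorem stackedSq_mix_sub_le (hW : WeightAssumption G W) (u w : Fin N → Vec K) (z : Vec K) :
    stackedSq (fun i => (∑ j, W i j • (u j + w j)) - u i)
      ≤ 8 * stackedSq (fun i => u i - z) + 2 * stackedSq w := by
  have h1 := stackedSq_add_le one_pos
    (fun i => (∑ j, W i j • (u j - z)) + (-1 : ℝ) • (u i - z)) fun i => ∑ j, W i j • w j
  have h2 := stackedSq_add_le one_pos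
    (fun i => ∑ j, W i j • (u j - z)) fun i => (-1 : ℝ) • (u i - z)
  rw [stackedSq_smul] at h2
  have h3 := hW.stackedSq_mix_le fun i => u i - z
  have h4 := hW.stackedSq_mix_le w
  have h5 : (fun i => (∑ j, W i j • (u j + w j)) - u i)
      = fun i => ((∑ j, W i j • (u j - z)) + (-1 : ℝ) • (u i - z)) + ∑ j, W i j • w j := by
    funext i
    simp only [smul_sub, smul_add, Finset.sum_sub_distrib, Finset.sum_add_distrib, hW.mix_const]
    module
  rw [h5]
  linarith

end WeightAssumption

/-! ### The proximal step on a compact set. -/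

section Prox

variable {K : ℕ} {X : Set (Vec K)}

/-- Compactness supplies a minimizer, so the default branch of `proxStep` never occurs for `x ∈ X`.
-/
theorem proxStep_spec (hX : IsCompact X) {x : Vec K} (hx : x ∈ X) (α : ℝ) (y : Vec K) :
    proxStep X α y x ∈ X ∧
      IsMinOn (fun q => inner ℝ y (q - x) + 1 / (2 * α) * ‖q - x‖ ^ 2) X
        (proxStep X α y x) := by
  have h : ∃ p ∈ X, IsMinOn (fun q => inner ℝ y (q - x) + 1 / (2 * α) * ‖q - x‖ ^ 2) X p :=
    hX.exists_isMinOn ⟨x, hx⟩ (by fun_prop)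
  rw [proxStep, dif_pos h]
  exact h.choose_spec

/-- Compare the minimizer with the competitor `x`, where the objective is zero. -/
theorem inner_proxStep_sub_le (hX : IsCompact X) {x : Vec K} (hx : x ∈ X) (α : ℝ) (y : Vec K) :
    inner ℝ y (proxStep X α y x - x) ≤ -(1 / (2 * α)) * ‖proxStep X α y x - x‖ ^ 2 := by
  have h := isMinOn_iff.1 (proxStep_spec hX hx α y).2 x hx
  simp at h ⊢
  linarith

/-- An interior solution of the proximal problem is a plain gradient step. -/
theorem proxStep_eq_of_norm_lt {z : Vec K} {ρ : ℝ} {x : Vec K}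
    (hx : x ∈ Metric.closedBall z ρ) {α : ℝ} (hα : 0 < α) (y : Vec K)
    (hlt : ‖proxStep (Metric.closedBall z ρ) α y x - z‖ < ρ) :
    proxStep (Metric.closedBall z ρ) α y x - x = -(α • y) := by
  have hspec := (proxStep_spec (isCompact_closedBall z ρ) hx α y).2
  set p := proxStep (Metric.closedBall z ρ) α y x with hp
  -- The residual of the gradient step. If it is nonzero, moving from `p` by a small `-s • w` stays
  -- in the ball and improves the objective.
  set w := (p - x) + α • y with hw
  suffices w = 0 from eq_neg_of_add_eq_zero_left this
  obtain ⟨s, hs0, hs1, hs⟩ : ∃ s : ℝ, 0 < s ∧ s ≤ 1 ∧ s * ‖w‖ ≤ ρ - ‖p - z‖ := by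
    have hpos : 0 < ρ - ‖p - z‖ := sub_pos.2 hlt
    refine ⟨min 1 ((ρ - ‖p - z‖) / (‖w‖ + 1)), lt_min one_pos (by positivity),
      min_le_left _ _, ?_⟩
    calc _ ≤ (ρ - ‖p - z‖) / (‖w‖ + 1) * (‖w‖ + 1) := by
          gcongr
          · exact min_le_right _ _
          · linarith
      _ = _ := by field_simp
  have hq : p - s • w ∈ Metric.closedBall z ρ := by
    rw [mem_closedBall_iff_norm]
    have h1 : p - s • w - z = (p - z) - s • w := by abel
    rw [h1]
    have := norm_sub_le (p - z) (s • w)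
    rw [norm_smul, Real.norm_of_nonneg hs0.le] at this
    linarith
  have hmin := isMinOn_iff.1 hspec _ hq
  -- Completing the square: up to a constant the objective is the squared distance to `x - α y`, so
  -- the move scales the residual by `1 - s`.
  have key : ∀ q : Vec K, inner ℝ y (q - x) + 1 / (2 * α) * ‖q - x‖ ^ 2
      = 1 / (2 * α) * ‖(q - x) + α • y‖ ^ 2 - α / 2 * ‖y‖ ^ 2 := by
    intro q
    rw [norm_add_sq_real, inner_smul_right, norm_smul, Real.norm_of_nonneg hα.le,
      real_inner_comm]
    field_simp
    ring
  simp only [key] at hmin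
  have h2 : (p - s • w - x) + α • y = (1 - s) • w := by
    rw [hw]
    module
  rw [h2, ← hw, norm_smul, mul_pow, Real.norm_eq_abs, sq_abs] at hmin
  have h3 : 0 < 1 / (2 * α) := by positivity
  have h4 : ‖w‖ ^ 2 ≤ (1 - s) ^ 2 * ‖w‖ ^ 2 :=
    le_of_mul_le_mul_left (by linarith) h3
  by_contra hne
  have h5 : 0 < ‖w‖ ^ 2 := by positivity
  have h6 : (1 - s) ^ 2 < 1 := by nlinarith
  nlinarith

end Prox

end Magenta

/-! ### Estimates for one inner iteration. -/

noncomputable section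

namespace Magenta

variable {N K : ℕ}

/-- The displacements `x̃ i - x i` of one inner iteration. -/
def direction (X : Set (Vec K)) (α : ℝ) (s : State N K) (i : Fin N) : Vec K :=
  proxStep X α (s.y i) (s.x i) - s.x i

theorem innerStep_x (f : Fin N → Vec K → ℝ) (W : Matrix (Fin N) (Fin N) ℝ) (X : Set (Vec K))
    (α β : ℝ) (s : State N K) :
    (innerStep f W X α β s).x = fun i => ∑ j, W i j • (s.x j + β • direction X α s j) := rfl

theorem innerStep_y (f : Fin N → Vec K → ℝ) (W : Matrix (Fin N) (Fin N) ℝ) (X : Set (Vec K))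
    (α β : ℝ) (s : State N K) :
    (innerStep f W X α β s).y = fun i => (∑ j, W i j • s.y j)
      + gradient (f i) ((innerStep f W X α β s).x i) - gradient (f i) (s.x i) := rfl

/-- The average of the `y i` tracks the average gradient. -/
def State.Tracks (f : Fin N → Vec K → ℝ) (s : State N K) : Prop :=
  average s.y = average fun i => gradient (f i) (s.x i)

theorem stackedSq_gradient_sub_le {f : Fin N → Vec K → ℝ} {X : Set (Vec K)} {L : ℝ}
    (hL : ∀ i, ∀ y ∈ X, ∀ z ∈ X, ‖gradient (f i) y - gradient (f i) z‖ ≤ L * ‖y - z‖)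
    {u w : Fin N → Vec K} (hu : ∀ i, u i ∈ X) (hw : ∀ i, w i ∈ X) :
    stackedSq (fun i => gradient (f i) (u i) - gradient (f i) (w i))
      ≤ L ^ 2 * stackedSq (fun i => u i - w i) := by
  simp only [stackedSq, Finset.mul_sum, ← mul_pow]
  exact Finset.sum_le_sum fun i _ =>
    pow_le_pow_left₀ (norm_nonneg _) (hL i _ (hu i) _ (hw i)) 2

theorem avgFun_le (hN : 0 < N) {f : Fin N → Vec K → ℝ} (hf : ∀ i, ContDiff ℝ 1 (f i))
    {X : Set (Vec K)} (hX : Convex ℝ X) {L : ℝ}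
    (hL : ∀ i, ∀ y ∈ X, ∀ z ∈ X, ‖gradient (f i) y - gradient (f i) z‖ ≤ L * ‖y - z‖)
    {a b : Vec K} (ha : a ∈ X) (hb : b ∈ X) :
    avgFun f b ≤ avgFun f a + inner ℝ (average fun i => gradient (f i) a) (b - a)
      + L / 2 * ‖b - a‖ ^ 2 := by
  have hN' : (0 : ℝ) < N := by positivity
  have h := Finset.sum_le_sum fun i (_ : i ∈ Finset.univ) =>
    le_add_inner_gradient (hf i) hX (hL i) ha hb
  simp only [Finset.sum_add_distrib, Finset.sum_const, Finset.card_univ, Fintype.card_fin,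
    nsmul_eq_mul, ← sum_inner] at h
  simp only [avgFun, average, real_inner_smul_left]
  have h2 := mul_le_mul_of_nonneg_left h (show 0 ≤ 1 / (N : ℝ) by positivity)
  refine h2.trans_eq ?_
  field_simp

section Step

variable {G : SimpleGraph (Fin N)} {W : Matrix (Fin N) (Fin N) ℝ}
  {f : Fin N → Vec K → ℝ} {X : Set (Vec K)} {α : ℝ} {s : State N K}

theorem innerStep_x_mem (hW : WeightAssumption G W) (hXc : Convex ℝ X) (hXk : IsCompact X)
    (hs : ∀ i, s.x i ∈ X) (i : Fin N) : (innerStep f W X α (1 / 2) s).x i ∈ X := by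
  rw [innerStep_x]
  refine hW.mix_mem hXc (fun j => ?_) i
  exact hXc.add_smul_sub_mem (hs j) (proxStep_spec hXk (hs j) α (s.y j)).1 (by norm_num)

theorem average_innerStep_x (hW : WeightAssumption G W) (β : ℝ) :
    average (innerStep f W X α β s).x = average s.x + β • average (direction X α s) := by
  rw [innerStep_x, hW.average_mix, average_add, average_smul]

theorem average_innerStep_y (hW : WeightAssumption G W) (β : ℝ) :
    average (innerStep f W X α β s).y = average s.y
      + average fun i => gradient (f i) ((innerStep f W X α β s).x i) - gradient (f i) (s.x i) := by
  rw [innerStep_y]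
  simp only [add_sub_assoc]
  rw [average_add, hW.average_mix]

/-- Mixing preserves averages, and the added gradient differences replace the old gradients by the
new ones. -/
theorem State.Tracks.innerStep (hW : WeightAssumption G W) (hs : s.Tracks f) (β : ℝ) :
    (innerStep f W X α β s).Tracks f := by
  unfold State.Tracks at hs ⊢
  rw [average_innerStep_y hW, average_sub, hs]
  abel

theorem consensusSq_innerStep_x_le (hN : 0 < N) (hW : WeightAssumption G W)
    {a : ℝ} (ha : 0 < a) :
    consensusSq (innerStep f W X α (1 / 2) s).x ≤ mixingRate W ^ 2 *
      ((1 + a) * consensusSq s.x + (1 + 1 / a) * (1 / 4 * stackedSq (direction X α s))) := by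
  have h := hW.stackedSq_mix_sub_average_le hN (fun j => s.x j + (1 / 2 : ℝ) • direction X α s j)
    (average s.x)
  have h2 := stackedSq_add_le ha (fun j => s.x j - average s.x)
    fun j => (1 / 2 : ℝ) • direction X α s j
  rw [stackedSq_smul] at h2
  have h3 : consensusSq (innerStep f W X α (1 / 2) s).x
      = stackedSq fun i => (∑ j, W i j • (s.x j + (1 / 2 : ℝ) • direction X α s j))
        - average fun j => s.x j + (1 / 2 : ℝ) • direction X α s j := by
    rw [consensusSq, innerStep_x, hW.average_mix]
  rw [h3]
  refine h.trans (mul_le_mul_of_nonneg_left ?_ (sq_nonneg _))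
  have h4 : (fun i => s.x i + (1 / 2 : ℝ) • direction X α s i - average s.x)
      = fun i => (s.x i - average s.x) + (1 / 2 : ℝ) • direction X α s i := by
    funext i
    abel
  rw [h4]
  refine h2.trans_eq ?_
  rw [consensusSq]
  norm_num

theorem stackedSq_innerStep_x_sub_le (hW : WeightAssumption G W) :
    stackedSq (fun i => (innerStep f W X α (1 / 2) s).x i - s.x i)
      ≤ 8 * consensusSq s.x + 1 / 2 * stackedSq (direction X α s) := by
  have h := hW.stackedSq_mix_sub_le s.x (fun j => (1 / 2 : ℝ) • direction X α s j) (average s.x)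
  rw [stackedSq_smul] at h
  rw [innerStep_x]
  refine h.trans_eq ?_
  rw [consensusSq]
  ring

/-- Mixing contracts the old error. The new error comes from gradient changes, bounded by `L` times
the movement of `x`; centring them only shrinks their norm. -/
theorem consensusSq_innerStep_y_le (hN : 0 < N) (hW : WeightAssumption G W)
    (hXc : Convex ℝ X) (hXk : IsCompact X) {L : ℝ}
    (hL : ∀ i, ∀ y ∈ X, ∀ z ∈ X, ‖gradient (f i) y - gradient (f i) z‖ ≤ L * ‖y - z‖)
    (hs : ∀ i, s.x i ∈ X) {a : ℝ} (ha : 0 < a) :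
    consensusSq (innerStep f W X α (1 / 2) s).y ≤
      (1 + a) * mixingRate W ^ 2 * consensusSq s.y + (1 + 1 / a) *
        (L ^ 2 * (8 * consensusSq s.x + 1 / 2 * stackedSq (direction X α s))) := by
  set s' := innerStep f W X α (1 / 2) s with hs'
  let d : Fin N → Vec K := fun i => gradient (f i) (s'.x i) - gradient (f i) (s.x i)
  have h1 := stackedSq_add_le ha (fun i => (∑ j, W i j • s.y j) - average s.y)
    fun i => d i - average d
  have h2 := hW.stackedSq_mix_sub_average_le hN s.y (average s.y)
  have h3 : stackedSq (fun i => d i - average d) ≤ stackedSq d := consensusSq_le_stackedSq hN d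
  have h4 : stackedSq d ≤ _ := stackedSq_gradient_sub_le hL
    (innerStep_x_mem (f := f) (α := α) hW hXc hXk hs) hs
  have h5 := stackedSq_innerStep_x_sub_le (f := f) (X := X) (α := α) (s := s) hW
  have h6 : consensusSq s'.y
      = stackedSq fun i => ((∑ j, W i j • s.y j) - average s.y) + (d i - average d) := by
    rw [consensusSq]
    congr 1
    funext i
    rw [average_innerStep_y hW, innerStep_y]
    simp only [d]
    abel
  rw [h6]
  refine h1.trans ?_
  rw [mul_assoc]
  have h7 := h3.trans (h4.trans (mul_le_mul_of_nonneg_left h5 (sq_nonneg L)))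
  gcongr
  exact h2

/-- Decrease of the average objective in one inner iteration, before the choice of the Young
weights `p` and `b`. -/
theorem avgFun_innerStep_le (hN : 0 < N) (hW : WeightAssumption G W)
    (hf : ∀ i, ContDiff ℝ 1 (f i)) (hXc : Convex ℝ X) (hXk : IsCompact X) {L : ℝ} (hL0 : 0 ≤ L)
    (hL : ∀ i, ∀ y ∈ X, ∀ z ∈ X, ‖gradient (f i) y - gradient (f i) z‖ ≤ L * ‖y - z‖)
    (hs : ∀ i, s.x i ∈ X) (ht : s.Tracks f) {p b : ℝ} (hp : 0 < p) (hb : 0 < b) :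
    avgFun f (average (innerStep f W X α (1 / 2) s).x) ≤ avgFun f (average s.x)
      + 1 / (2 * N) * (p / 2 * (L ^ 2 * consensusSq s.x) + b / 2 * consensusSq s.y
        + (1 / (2 * p) + 1 / (2 * b) - 1 / (2 * α)) * stackedSq (direction X α s))
      + L / (8 * N) * stackedSq (direction X α s) := by
  have hN' : (0 : ℝ) < N := by positivity
  have hmem : average s.x ∈ X := average_mem hN hXc hs
  have hmem' : average (innerStep f W X α (1 / 2) s).x ∈ X :=
    average_mem hN hXc (innerStep_x_mem hW hXc hXk hs)
  have h1 := avgFun_le hN hf hXc hL hmem hmem'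
  set v := direction X α s with hv
  set g : Vec K := average fun i => gradient (f i) (average s.x) with hg
  rw [average_innerStep_x hW, add_sub_cancel_left, inner_smul_right, norm_smul, ← hv] at h1
  have h2 : (N : ℝ) * inner ℝ g (average v) = ∑ i, inner ℝ g (v i) := by
    rw [← inner_sum, ← nat_smul_average hN, inner_smul_right]
  -- Split `g = (g - ȳ) + (ȳ - y i) + y i`. The first part is a consensus error of `x` by tracking,
  -- the second a tracking error, and the third gives descent by proximal minimality.
  have h3 : ∀ i, inner ℝ g (v i) ≤ (p / 2 * ‖g - average s.y‖ ^ 2 + 1 / (2 * p) * ‖v i‖ ^ 2)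
      + (b / 2 * ‖s.y i - average s.y‖ ^ 2 + 1 / (2 * b) * ‖v i‖ ^ 2)
      + -(1 / (2 * α)) * ‖v i‖ ^ 2 := by
    intro i
    have e1 := inner_le_young hp (g - average s.y) (v i)
    have e2 := inner_le_young hb (average s.y - s.y i) (v i)
    have e3 : inner ℝ (s.y i) (v i) ≤ -(1 / (2 * α)) * ‖v i‖ ^ 2 :=
      inner_proxStep_sub_le hXk (hs i) α (s.y i)
    rw [norm_sub_rev] at e2
    simp only [inner_sub_left] at e1 e2
    linarith
  have h4 := Finset.sum_le_sum fun i (_ : i ∈ Finset.univ) => h3 i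
  rw [← h2] at h4
  simp only [Finset.sum_add_distrib, ← Finset.mul_sum, Finset.sum_const, Finset.card_univ,
    Fintype.card_fin, nsmul_eq_mul] at h4
  have h5 : (N : ℝ) * ‖g - average s.y‖ ^ 2 ≤ L ^ 2 * consensusSq s.x := by
    rw [ht, hg, ← average_sub, ← norm_neg, ← neg_one_smul ℝ, ← average_smul]
    refine (norm_average_sq_le hN _).trans ?_
    rw [stackedSq_smul, neg_one_sq, one_mul]
    refine (stackedSq_gradient_sub_le hL (fun _ => hmem) hs).trans_eq ?_
    simp only [consensusSq, stackedSq, norm_sub_rev]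
  have h6 : (N : ℝ) * ‖average v‖ ^ 2 ≤ stackedSq v := norm_average_sq_le hN v
  change (N : ℝ) * inner ℝ g (average v) ≤ (p / 2 * (N * ‖g - average s.y‖ ^ 2)
    + 1 / (2 * p) * stackedSq v) + (b / 2 * consensusSq s.y + 1 / (2 * b) * stackedSq v)
    + -(1 / (2 * α)) * stackedSq v at h4
  have h7 : inner ℝ g (average v) ≤ 1 / N * (p / 2 * (L ^ 2 * consensusSq s.x)
      + b / 2 * consensusSq s.y
      + (1 / (2 * p) + 1 / (2 * b) - 1 / (2 * α)) * stackedSq v) := by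
    rw [one_div_mul_eq_div, le_div_iff₀' hN']
    have := mul_le_mul_of_nonneg_left h5 (show 0 ≤ p / 2 by positivity)
    linarith
  have h8 : L / 2 * (‖(1 / 2 : ℝ)‖ * ‖average v‖) ^ 2 ≤ L / (8 * N) * stackedSq v := by
    have : ‖average v‖ ^ 2 ≤ stackedSq v / N := by rwa [le_div_iff₀' hN']
    have := mul_le_mul_of_nonneg_left this (show 0 ≤ L / 8 by positivity)
    calc _ = L / 8 * ‖average v‖ ^ 2 := by norm_num; ring
      _ ≤ _ := this
      _ = _ := by field_simp
  rw [average_innerStep_x hW]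
  have h9 : 1 / (2 * (N : ℝ)) = 1 / 2 * (1 / N) := by field_simp
  rw [h9, mul_assoc]
  linarith

/-- Descent of the potential in one inner iteration. -/
theorem potential_innerStep_le (hN : 0 < N) (hW : WeightAssumption G W)
    (hf : ∀ i, ContDiff ℝ 1 (f i)) (hXc : Convex ℝ X) (hXk : IsCompact X) {L : ℝ} (hL1 : 1 ≤ L)
    (hL : ∀ i, ∀ y ∈ X, ∀ z ∈ X, ‖gradient (f i) y - gradient (f i) z‖ ≤ L * ‖y - z‖)
    (hs : ∀ i, s.x i ∈ X) (ht : s.Tracks f) {γ ξ κ κ' c : ℝ} (hγ : 0 < γ) (hξ : 0 < ξ)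
    (hκ : κ = 1 - (1 + γ) * mixingRate W ^ 2) (hκ' : κ' = 1 - (1 + ξ) * mixingRate W ^ 2)
    (hκ0 : 0 < κ) (hκ0' : 0 < κ') (hc : c = κ / (32 * (1 + 1 / ξ) * L ^ 2))
    (hα₁ : 4 * L + 8 * N / γ + 10 * N ≤ 1 / α)
    (hα₂ : 64 * (1 + 1 / ξ) * L ^ 2 / (N * κ * κ') ≤ 1 / α) :
    avgFun f (average (innerStep f W X α (1 / 2) s).x)
        + consensusSq (innerStep f W X α (1 / 2) s).x
        + c * consensusSq (innerStep f W X α (1 / 2) s).y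
        + (1 / (8 * N) * (1 / α) * stackedSq (direction X α s) + κ / 2 * consensusSq s.x
          + c * κ' / 2 * consensusSq s.y)
      ≤ avgFun f (average s.x) + consensusSq s.x + c * consensusSq s.y := by
  have hN' : (0 : ℝ) < N := by positivity
  have hN1 : (1 : ℝ) ≤ N := by exact_mod_cast hN
  have hL0 : 0 < L := by linarith
  have hc0 : 0 < c := by rw [hc]; positivity
  have hη : mixingRate W ^ 2 ≤ 1 := by nlinarith [sq_nonneg (mixingRate W)]
  have hκ1 : κ ≤ 1 := by rw [hκ]; nlinarith [sq_nonneg (mixingRate W)]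
  have hκ1' : κ' ≤ 1 := by rw [hκ']; nlinarith [sq_nonneg (mixingRate W)]
  -- `p` and `b` are chosen so that the objective costs exactly `κ/4 · E` and `c κ'/2 · Y` (`e2`,
  -- `e3`). The value of `c` makes the gradient changes cost another `κ/4 · E` (`e1`). Contraction
  -- supplies `κ E` and `c κ' Y`, so half of each survives.
  set p : ℝ := N * κ / L ^ 2 with hp
  set b : ℝ := 2 * N * c * κ' with hb
  have hp0 : 0 < p := by positivity
  have hb0 : 0 < b := by positivity
  have hF := avgFun_innerStep_le (α := α) hN hW hf hXc hXk hL0.le hL hs ht hp0 hb0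
  have hE := consensusSq_innerStep_x_le (f := f) (X := X) (α := α) (s := s) hN hW hγ
  have hY := mul_le_mul_of_nonneg_left
    (consensusSq_innerStep_y_le (α := α) hN hW hXc hXk hL hs hξ) hc0.le
  set V := stackedSq (direction X α s)
  have hV : 0 ≤ V := stackedSq_nonneg _
  set E := consensusSq s.x
  set Y := consensusSq s.y
  set m := 1 / α with hm
  have e1 : c * ((1 + 1 / ξ) * (L ^ 2 * (8 * E + 1 / 2 * V))) = κ / 32 * (8 * E + 1 / 2 * V) := by
    rw [hc]
    have : 1 + 1 / ξ ≠ 0 := by positivity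
    field_simp
  have e2 : 1 / (2 * (N : ℝ)) * (p / 2 * (L ^ 2 * E)) = κ / 4 * E := by
    rw [hp]
    field_simp
    ring
  have e3 : 1 / (2 * (N : ℝ)) * (b / 2 * Y) = c * κ' / 2 * Y := by
    rw [hb]
    field_simp
  have e4 : 1 / (2 * p) ≤ m / 128 := by
    have h1 : 1 / (2 * p) = 1 / 2 * (L ^ 2 / (N * κ)) := by
      rw [hp]
      field_simp
    have h2 : L ^ 2 / (N * κ) ≤ (1 + 1 / ξ) * L ^ 2 / (N * κ * κ') := by
      apply div_le_div₀ (by positivity) _ (by positivity)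
      · exact mul_le_of_le_one_right (by positivity) hκ1'
      · exact le_mul_of_one_le_left (by positivity) (by simp [hξ.le])
    have h3 : 64 * (1 + 1 / ξ) * L ^ 2 / (N * κ * κ')
        = 64 * ((1 + 1 / ξ) * L ^ 2 / (N * κ * κ')) := by ring
    linarith
  have e5 : 1 / (2 * b) ≤ m / 8 := by
    have h1 : 1 / (2 * b) = 1 / 8 * (64 * (1 + 1 / ξ) * L ^ 2 / (N * κ * κ')) := by
      rw [hb, hc]
      have : 1 + 1 / ξ ≠ 0 := by positivity
      field_simp
      norm_num
    linarith
  -- All remaining positive coefficients of `V`: smoothness, consensus of `x`, and tracking with `κ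
  -- ≤ 1`. In units of `m / N` the total is at most `1/256 + 1/16 - 1/4 + 1/32 = -39/256`, below the
  -- required `-1/8`.
  have e6 : L / (8 * N) + (1 + 1 / γ) / 4 + 1 / 64 ≤ 1 / N * (m / 32) := by
    have h1 : L / (8 * N) + (1 + 1 / γ) / 4 + 1 / 64
        = 1 / N * (L / 8 + N / γ / 4 + N * (17 / 64)) := by
      field_simp
      ring
    rw [h1]
    gcongr
    have h2 : 8 * (N : ℝ) / γ = 8 * (N / γ) := by ring
    linarith
  have e7 : mixingRate W ^ 2 * ((1 + γ) * E + (1 + 1 / γ) * (1 / 4 * V))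
      ≤ (1 - κ) * E + (1 + 1 / γ) / 4 * V := by
    have h1 := mul_le_mul_of_nonneg_right hη (show 0 ≤ (1 + 1 / γ) / 4 * V by positivity)
    rw [hκ]
    linarith
  have e8 : c * ((1 + ξ) * mixingRate W ^ 2 * Y) = c * (1 - κ') * Y := by
    rw [hκ']
    ring
  have e9 : 1 / (2 * (N : ℝ)) * ((1 / (2 * p) + 1 / (2 * b) - 1 / (2 * α)) * V)
      ≤ 1 / N * (m / 256 + m / 16 - m / 4) * V := by
    have h1 : 1 / (2 * α) = m / 2 := by rw [hm]; ring
    have h2 : 1 / (2 * p) + 1 / (2 * b) - 1 / (2 * α) ≤ m / 128 + m / 8 - m / 2 := by linarith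
    calc _ ≤ 1 / (2 * (N : ℝ)) * ((m / 128 + m / 8 - m / 2) * V) := by gcongr
      _ = _ := by field_simp; ring
  have e10 := mul_le_mul_of_nonneg_right e6 hV
  have e11 : κ * V ≤ V := mul_le_of_le_one_left hV hκ1
  have e12 : 0 ≤ 1 / N * m * V := by
    have : 0 ≤ m := le_trans (by positivity) hα₁
    positivity
  have e13 : 1 / (8 * (N : ℝ)) * m * V = 1 / 8 * (1 / N * m * V) := by field_simp
  have hF' : avgFun f (average (innerStep f W X α (1 / 2) s).x) ≤ avgFun f (average s.x)
      + κ / 4 * E + c * κ' / 2 * Y + 1 / N * (m / 256 + m / 16 - m / 4) * V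
      + L / (8 * N) * V := by
    rw [mul_add, mul_add, e2, e3] at hF
    linarith
  have hE' := hE.trans e7
  rw [mul_add, e1, e8] at hY
  rw [e13]
  linarith

end Step

end Magenta

end

/-! ### The whole run: stepsizes, invariants and the potential. -/

noncomputable section

namespace Magenta

namespace Input

variable {N K : ℕ}

/-- The standing assumptions on a run of the algorithm. -/
structure Admissible (M : Input N K) (G : SimpleGraph (Fin N)) (fLow : ℝ) : Prop where
  agents : 0 < N
  problem : ProblemAssumption M.f M.Lip fLow
  weights : WeightAssumption G M.W
  γ_pos : 0 < M.γ
  ξ_pos : 0 < M.ξ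
  γ_rate : (1 + M.γ) * M.η ^ 2 < 1
  ξ_rate : (1 + M.ξ) * M.η ^ 2 < 1
  v_zero : 0 ≤ M.v 0
  v_mono : Monotone M.v
  x₀_mem : ∀ i, M.x₀ i ∈ M.X 1
  ε_pos : 0 < M.ε
  ε_lt : M.ε < 2 * (1 - (1 + M.γ) * M.η ^ 2)

/-- The weight of the tracking error in the potential. -/
def trackingWeight (M : Input N K) (t : ℕ) : ℝ :=
  (1 - (1 + M.γ) * M.η ^ 2) / (32 * (1 + 1 / M.ξ) * M.Lhat t ^ 2)

/-- The displacements of iteration `r` of stage `t`. -/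
def displacement (M : Input N K) (t r : ℕ) : Fin N → Vec K :=
  direction (M.X t) (M.α t) (M.iter t r)

/-- A lower bound for the decrease of the potential in iteration `r` of stage `t`. -/
def decrease (M : Input N K) (t r : ℕ) : ℝ :=
  1 / (8 * N) * (1 / M.α t) * stackedSq (M.displacement t r)
    + (1 - (1 + M.γ) * M.η ^ 2) / 2 * consensusSq (M.iter t r).x
    + M.trackingWeight t * (1 - (1 + M.ξ) * M.η ^ 2) / 2 * consensusSq (M.iter t r).y

theorem iter_zero (M : Input N K) (t : ℕ) : M.iter t 0 = M.afterStages (t - 1) := rfl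

theorem iter_succ (M : Input N K) (t r : ℕ) :
    M.iter t (r + 1) = M.stageStep t (M.iter t r) :=
  Function.iterate_succ_apply' _ _ _

theorem afterStages_succ (M : Input N K) (t : ℕ) :
    M.afterStages (t + 1) = M.iter (t + 1) (M.R (t + 1)) := rfl

theorem rounds_iter (M : Input N K) (t r : ℕ) :
    (M.iter t r).rounds = (M.afterStages (t - 1)).rounds + r := by
  induction r with
  | zero => rfl
  | succ r ih =>
    rw [iter_succ]
    change (M.iter t r).rounds + 1 = _
    rw [ih, add_assoc]

theorem rounds_afterStages (M : Input N K) (T : ℕ) :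
    (M.afterStages T).rounds = ∑ t ∈ Finset.Icc 1 T, M.R t := by
  induction T with
  | zero => rfl
  | succ T ih =>
    rw [afterStages_succ, rounds_iter, Finset.sum_Icc_succ_top (by omega), ← ih,
      Nat.add_sub_cancel]

theorem sum_one_div (M : Input N K) (T : ℕ) :
    1 / M.ε * ∑ t ∈ Finset.Icc 1 T, 1 / M.α t
      = ∑ t ∈ Finset.Icc 1 T, 1 / (M.ε * M.α t) := by
  rw [Finset.mul_sum]
  exact Finset.sum_congr rfl fun t _ => (one_div_mul_one_div _ _)

theorem isCompact_X (M : Input N K) (t : ℕ) : IsCompact (M.X t) := isCompact_closedBall _ _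

theorem convex_X (M : Input N K) (t : ℕ) : Convex ℝ (M.X t) := convex_closedBall _ _

theorem X_mono {M : Input N K} (hv : Monotone M.v) {s t : ℕ} (h : s ≤ t) : M.X s ⊆ M.X t :=
  Metric.closedBall_subset_closedBall (hv h)

theorem lip_le_Lhat (M : Input N K) (t : ℕ) (i : Fin N) : M.Lip i (M.X t) ≤ M.Lhat t :=
  le_ciSup (f := fun i => M.Lip i (M.X t)) (Set.finite_range _).bddAbove i

namespace Admissible

variable {M : Input N K} {G : SimpleGraph (Fin N)} {fLow : ℝ}

theorem N_pos (h : M.Admissible G fLow) : (0 : ℝ) < N := by exact_mod_cast h.agents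

theorem κ_pos (h : M.Admissible G fLow) : 0 < 1 - (1 + M.γ) * M.η ^ 2 := sub_pos.2 h.γ_rate

theorem κ'_pos (h : M.Admissible G fLow) : 0 < 1 - (1 + M.ξ) * M.η ^ 2 := sub_pos.2 h.ξ_rate

theorem ε_lt_two (h : M.Admissible G fLow) : M.ε < 2 := by
  have h1 := h.ε_lt
  have h2 : 0 ≤ (1 + M.γ) * M.η ^ 2 := mul_nonneg (by linarith [h.γ_pos]) (sq_nonneg _)
  linarith

theorem one_le_Lhat (h : M.Admissible G fLow) (t : ℕ) : 1 ≤ M.Lhat t :=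
  (h.problem.one_le ⟨0, h.agents⟩ _ (M.isCompact_X t)).trans (M.lip_le_Lhat t _)

theorem Lhat_mono (h : M.Admissible G fLow) {s t : ℕ} (hst : s ≤ t) : M.Lhat s ≤ M.Lhat t := by
  have : Nonempty (Fin N) := ⟨⟨0, h.agents⟩⟩
  exact ciSup_le fun i => (h.problem.mono i _ _ (M.isCompact_X s) (M.isCompact_X t)
    (X_mono h.v_mono hst)).trans (M.lip_le_Lhat t i)

theorem lipschitz_X (h : M.Admissible G fLow) (t : ℕ) (i : Fin N) :
    ∀ y ∈ M.X t, ∀ z ∈ M.X t,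
      ‖gradient (M.f i) y - gradient (M.f i) z‖ ≤ M.Lhat t * ‖y - z‖ := fun y hy z hz =>
  (h.problem.lipschitz i _ (M.isCompact_X t) y hy z hz).trans
    (mul_le_mul_of_nonneg_right (M.lip_le_Lhat t i) (norm_nonneg _))

/-- The reciprocal of the stepsize. -/
theorem one_div_α (h : M.Admissible G fLow) (t : ℕ) :
    1 / M.α t = max (max (4 * M.Lhat t + 8 * N / M.γ + 10 * N)
      (64 * (1 + 1 / M.ξ) * M.Lhat t ^ 2
        / (N * (1 - (1 + M.γ) * M.η ^ 2) * (1 - (1 + M.ξ) * M.η ^ 2)))) 1 := by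
  have hN := h.N_pos
  have hκ := h.κ_pos
  have hκ' := h.κ'_pos
  have hγ := h.γ_pos
  have hξ := h.ξ_pos
  have hL : 0 < M.Lhat t := one_pos.trans_le (h.one_le_Lhat t)
  have key : ∀ {a b : ℝ}, 0 < a → 0 < b → 1 / min a b = max (1 / a) (1 / b) := by
    intro a b ha hb
    rcases le_total a b with hab | hab
    · rw [min_eq_left hab, max_eq_left (one_div_le_one_div_of_le ha hab)]
    · rw [min_eq_right hab, max_eq_right (one_div_le_one_div_of_le hb hab)]
  have h1 : 0 < 1 / (8 * (N : ℝ)) * (1 / (M.Lhat t / (2 * N) + (1 / M.γ + 5 / 4))) := by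
    positivity
  have h2 : 0 < N * (1 - (1 + M.γ) * M.η ^ 2) * (1 - (1 + M.ξ) * M.η ^ 2)
      / (64 * (1 + 1 / M.ξ) * M.Lhat t ^ 2) := by positivity
  rw [Input.α, key (lt_min h1 h2) one_pos, key h1 h2, one_div_one, one_div_div]
  congr 2
  field_simp
  ring

theorem one_div_α_bounds (h : M.Admissible G fLow) (t : ℕ) :
    4 * M.Lhat t + 8 * N / M.γ + 10 * N ≤ 1 / M.α t ∧
      64 * (1 + 1 / M.ξ) * M.Lhat t ^ 2
        / (N * (1 - (1 + M.γ) * M.η ^ 2) * (1 - (1 + M.ξ) * M.η ^ 2)) ≤ 1 / M.α t := by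
  rw [h.one_div_α]
  exact ⟨(le_max_left _ _).trans (le_max_left _ _), (le_max_right _ _).trans (le_max_left _ _)⟩

theorem ten_mul_le_one_div_α (h : M.Admissible G fLow) (t : ℕ) : 10 * N ≤ 1 / M.α t := by
  have h1 := (h.one_div_α_bounds t).1
  have h2 := h.one_le_Lhat t
  have h3 : 0 < 8 * (N : ℝ) / M.γ := div_pos (by linarith [h.N_pos]) h.γ_pos
  linarith

theorem one_le_N (h : M.Admissible G fLow) : (1 : ℝ) ≤ N := by exact_mod_cast h.agents

theorem α_pos (h : M.Admissible G fLow) (t : ℕ) : 0 < M.α t :=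
  one_div_pos.1 (by linarith [h.ten_mul_le_one_div_α t, h.N_pos])

theorem one_div_ε_mul_α_pos (h : M.Admissible G fLow) (t : ℕ) : 0 < 1 / (M.ε * M.α t) :=
  one_div_pos.2 (mul_pos h.ε_pos (h.α_pos t))

theorem trackingWeight_pos (h : M.Admissible G fLow) (t : ℕ) : 0 < M.trackingWeight t := by
  have hκ := h.κ_pos
  have hξ := h.ξ_pos
  have hL : 0 < M.Lhat t := one_pos.trans_le (h.one_le_Lhat t)
  unfold trackingWeight
  positivity

theorem decrease_nonneg (h : M.Admissible G fLow) (t r : ℕ) : 0 ≤ M.decrease t r := by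
  have hκ := h.κ_pos
  have hκ' := h.κ'_pos
  have hα := h.α_pos t
  have hc := h.trackingWeight_pos t
  have h1 := stackedSq_nonneg (M.displacement t r)
  have h2 := consensusSq_nonneg (M.iter t r).x
  have h3 := consensusSq_nonneg (M.iter t r).y
  unfold decrease
  positivity

theorem iter_inv (h : M.Admissible G fLow) {t : ℕ} (hx : ∀ i, (M.iter t 0).x i ∈ M.X t)
    (ht : (M.iter t 0).Tracks M.f) (r : ℕ) :
    (∀ i, (M.iter t r).x i ∈ M.X t) ∧ (M.iter t r).Tracks M.f := by
  induction r with
  | zero => exact ⟨hx, ht⟩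
  | succ r ih =>
    rw [iter_succ]
    exact ⟨innerStep_x_mem h.weights (M.convex_X t) (M.isCompact_X t) ih.1,
      ih.2.innerStep h.weights _⟩

/-- The average is located in the smaller ball `X t`, not just in `X (t + 1)`; this is what forces a
boundary stage to cross a full shell. Initially it is the centre, so `0 ≤ v 0` suffices. -/
theorem afterStages_inv (h : M.Admissible G fLow) (t : ℕ) :
    (∀ i, (M.afterStages t).x i ∈ M.X (t + 1)) ∧ average (M.afterStages t).x ∈ M.X t ∧
      (M.afterStages t).Tracks M.f := by
  induction t with
  | zero => exact ⟨h.x₀_mem, Metric.mem_closedBall_self h.v_zero, rfl⟩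
  | succ t ih =>
    have h1 := h.iter_inv (t := t + 1) ih.1 ih.2.2 (M.R (t + 1))
    rw [afterStages_succ]
    exact ⟨fun i => X_mono h.v_mono (Nat.le_succ _) (h1.1 i),
      average_mem h.agents (M.convex_X _) h1.1, h1.2⟩

theorem iter_mem (h : M.Admissible G fLow) {t : ℕ} (ht : 1 ≤ t) (r : ℕ) (i : Fin N) :
    (M.iter t r).x i ∈ M.X t := by
  obtain ⟨t, rfl⟩ := Nat.exists_eq_add_of_le' ht
  exact (h.iter_inv (h.afterStages_inv t).1 (h.afterStages_inv t).2.2 r).1 i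

theorem iter_tracks (h : M.Admissible G fLow) {t : ℕ} (ht : 1 ≤ t) (r : ℕ) :
    (M.iter t r).Tracks M.f := by
  obtain ⟨t, rfl⟩ := Nat.exists_eq_add_of_le' ht
  exact (h.iter_inv (h.afterStages_inv t).1 (h.afterStages_inv t).2.2 r).2

theorem potential_iter_le (h : M.Admissible G fLow) {t : ℕ} (ht : 1 ≤ t) (r : ℕ) :
    M.potential (M.iter t r).x (M.iter t r).y t + ∑ q ∈ Finset.range r, M.decrease t q
      ≤ M.potential (M.afterStages (t - 1)).x (M.afterStages (t - 1)).y t := by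
  induction r with
  | zero => simp [iter_zero]
  | succ r ih =>
    have h1 := potential_innerStep_le (s := M.iter t r) h.agents h.weights h.problem.contDiff
      (M.convex_X t) (M.isCompact_X t) (h.one_le_Lhat t) (h.lipschitz_X t) (h.iter_mem ht r)
      (h.iter_tracks ht r) h.γ_pos h.ξ_pos rfl rfl h.κ_pos h.κ'_pos rfl
      (h.one_div_α_bounds t).1 (h.one_div_α_bounds t).2
    change M.potential (M.stageStep t (M.iter t r)).x (M.stageStep t (M.iter t r)).y t
      + M.decrease t r ≤ M.potential (M.iter t r).x (M.iter t r).y t at h1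
    rw [Finset.sum_range_succ, iter_succ]
    linarith

/-- Only the tracking weight depends on `t`, and it decreases because `Lhat` grows with the feasible
set. -/
theorem potential_succ_le (h : M.Admissible G fLow) (x y : Fin N → Vec K) (t : ℕ) :
    M.potential x y (t + 1) ≤ M.potential x y t := by
  have hκ := h.κ_pos
  have hξ := h.ξ_pos
  have hL : 0 < M.Lhat t := one_pos.trans_le (h.one_le_Lhat t)
  have hL' := h.Lhat_mono (Nat.le_succ t)
  have := consensusSq_nonneg y
  unfold potential
  gcongr

theorem lt_potential (h : M.Admissible G fLow) (x y : Fin N → Vec K) (t : ℕ) :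
    fLow < M.potential x y t := by
  have h1 := h.problem.lower (average x)
  have h2 := consensusSq_nonneg x
  have h3 := mul_nonneg (h.trackingWeight_pos t).le (consensusSq_nonneg y)
  change fLow < avgFun M.f (average x) + consensusSq x + M.trackingWeight t * consensusSq y
  linarith

/-- The total decrease of the potential over the stages `1, …, T`. -/
theorem potential_afterStages_le (h : M.Admissible G fLow) (T : ℕ) :
    M.potential (M.afterStages T).x (M.afterStages T).y (T + 1)
      + ∑ t ∈ Finset.Icc 1 T, ∑ q ∈ Finset.range (M.R t), M.decrease t q
      ≤ M.initialPotential := by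
  induction T with
  | zero => simp [initialPotential, afterStages]
  | succ T ih =>
    rw [Finset.sum_Icc_succ_top (by omega), afterStages_succ]
    have h1 := h.potential_iter_le (t := T + 1) (by omega) (M.R (T + 1))
    have h2 := h.potential_succ_le (M.iter (T + 1) (M.R (T + 1))).x
      (M.iter (T + 1) (M.R (T + 1))).y (T + 1)
    rw [Nat.add_sub_cancel] at h1
    linarith

theorem sum_decrease_lt (h : M.Admissible G fLow) (T : ℕ) :
    ∑ t ∈ Finset.Icc 1 T, ∑ q ∈ Finset.range (M.R t), M.decrease t q
      < M.initialPotential - fLow := by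
  have h1 := h.potential_afterStages_le T
  have h2 := h.lt_potential (M.afterStages T).x (M.afterStages T).y (T + 1)
  linarith

theorem sum_stage_decrease_le (h : M.Admissible G fLow) {t : ℕ} (ht : 1 ≤ t) :
    ∑ q ∈ Finset.range (M.R t), M.decrease t q ≤ M.initialPotential - fLow :=
  (Finset.single_le_sum (f := fun t => ∑ q ∈ Finset.range (M.R t), M.decrease t q)
    (fun t _ => Finset.sum_nonneg fun q _ => h.decrease_nonneg t q)
    (Finset.mem_Icc.2 ⟨ht, le_rfl⟩)).trans (h.sum_decrease_lt t).le

/-! ### Interior stages against boundary stages. -/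

/-- A stage whose proximal points all lie in the interior of the feasible set has a small gap. -/
theorem avgGap_le_of_interior (h : M.Admissible G fLow) {t : ℕ} (ht : 1 ≤ t)
    (hint : ∀ r < M.R t, ∀ i, ‖proxStep (M.X t) (M.α t) ((M.iter t r).y i) ((M.iter t r).x i)
      - average M.x₀‖ < M.v t) :
    M.avgGap t ≤ M.gapConst * (M.initialPotential - fLow) * M.ε := by
  have hN := h.N_pos
  have hκ := h.κ_pos
  have hκ' := h.κ'_pos
  have hα := h.α_pos t
  have hε := h.ε_pos
  have hξ := h.ξ_pos
  have hL : 0 < M.Lhat t := one_pos.trans_le (h.one_le_Lhat t)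
  have hm1 : 1 ≤ 1 / M.α t := by linarith [h.ten_mul_le_one_div_α t, h.one_le_N]
  have hm2 := (h.one_div_α_bounds t).2
  have hC1 : 32 * (N : ℝ) ≤ M.gapConst := (le_max_left _ _).trans (le_max_left _ _)
  have hC2 : 4 / (1 - (1 + M.γ) * M.η ^ 2) ≤ M.gapConst :=
    (le_max_right _ _).trans (le_max_left _ _)
  have hC : 0 < M.gapConst := lt_of_lt_of_le (by positivity) hC1
  -- Each term of the gap is paid by its counterpart in `decrease`, at the price `1 / α`. For `y`,
  -- `C ≥ 8N` is enough; for the consensus of `x`, `C κ ≥ 4` and `1 / α ≥ 1`; for the tracking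
  -- error, `C ≥ N` with the second bound on `α`.
  have hterm : ∀ r < M.R t, stackedSq (M.iter t r).y + consensusSq (M.iter t r).x
      + consensusSq (M.iter t r).y ≤ M.gapConst * (1 / M.α t) * M.decrease t r := by
    intro r hr
    have hE := consensusSq_nonneg (M.iter t r).x
    have hY := consensusSq_nonneg (M.iter t r).y
    have hS := stackedSq_nonneg (M.iter t r).y
    have hV : stackedSq (M.displacement t r) = M.α t ^ 2 * stackedSq (M.iter t r).y := by
      rw [← neg_sq, ← stackedSq_smul]
      congr 1
      funext i
      rw [neg_smul]
      exact proxStep_eq_of_norm_lt (h.iter_mem ht r i) hα _ (hint r hr i)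
    have e1 : stackedSq (M.iter t r).y ≤ M.gapConst * (1 / M.α t)
        * (1 / (8 * N) * (1 / M.α t) * stackedSq (M.displacement t r)) := by
      have : M.gapConst * (1 / M.α t)
          * (1 / (8 * N) * (1 / M.α t) * stackedSq (M.displacement t r))
          = M.gapConst / (8 * N) * stackedSq (M.iter t r).y := by
        rw [hV]
        field_simp
      rw [this]
      refine le_mul_of_one_le_left hS ?_
      rw [le_div_iff₀ (by positivity)]
      linarith
    have e2 : consensusSq (M.iter t r).x ≤ M.gapConst * (1 / M.α t)
        * ((1 - (1 + M.γ) * M.η ^ 2) / 2 * consensusSq (M.iter t r).x) := by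
      rw [← mul_assoc]
      refine le_mul_of_one_le_left hE ?_
      rw [div_le_iff₀ hκ] at hC2
      have : 1 * M.gapConst ≤ 1 / M.α t * M.gapConst := by gcongr
      nlinarith
    have e3 : consensusSq (M.iter t r).y ≤ M.gapConst * (1 / M.α t)
        * (M.trackingWeight t * (1 - (1 + M.ξ) * M.η ^ 2) / 2
          * consensusSq (M.iter t r).y) := by
      rw [← mul_assoc]
      refine le_mul_of_one_le_left hY ?_
      have hne : 1 + 1 / M.ξ ≠ 0 := by positivity
      have hc : 0 < M.trackingWeight t * (1 - (1 + M.ξ) * M.η ^ 2) / 2 := by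
        have := h.trackingWeight_pos t
        positivity
      have h1 : 64 * (1 + 1 / M.ξ) * M.Lhat t ^ 2
          / (N * (1 - (1 + M.γ) * M.η ^ 2) * (1 - (1 + M.ξ) * M.η ^ 2))
          = 1 / (N * (M.trackingWeight t * (1 - (1 + M.ξ) * M.η ^ 2) / 2)) := by
        unfold trackingWeight
        field_simp
        norm_num
      rw [h1, div_le_iff₀ (by positivity)] at hm2
      have h2 : (N : ℝ) ≤ M.gapConst := by linarith
      calc (1 : ℝ) ≤ N * (1 / M.α t) * (M.trackingWeight t * (1 - (1 + M.ξ) * M.η ^ 2) / 2) := by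
            linarith
        _ ≤ _ := by gcongr
    unfold decrease
    rw [mul_add, mul_add]
    linarith
  have hR : 1 / (M.ε * M.α t) ≤ (M.R t : ℝ) := Nat.le_ceil _
  -- Rounding `R` up is the favourable direction here; the factor `α` cancels the price `1 / α`.
  have hR' : 1 / (M.R t : ℝ) ≤ M.ε * M.α t := by
    have := one_div_le_one_div_of_le (h.one_div_ε_mul_α_pos t) hR
    rwa [one_div_one_div] at this
  have hsum : ∑ r ∈ Finset.range (M.R t),
      (stackedSq (M.iter t r).y + consensusSq (M.iter t r).x + consensusSq (M.iter t r).y)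
      ≤ M.gapConst * (1 / M.α t) * (M.initialPotential - fLow) := by
    refine (Finset.sum_le_sum fun r hr => hterm r (Finset.mem_range.1 hr)).trans ?_
    rw [← Finset.mul_sum]
    have := h.sum_stage_decrease_le ht
    gcongr
  have hP : 0 < M.initialPotential - fLow := sub_pos.2 (h.lt_potential _ _ _)
  calc M.avgGap t
      ≤ 1 / (M.R t : ℝ) * (M.gapConst * (1 / M.α t) * (M.initialPotential - fLow)) := by
        unfold avgGap
        gcongr
    _ ≤ M.ε * M.α t * (M.gapConst * (1 / M.α t) * (M.initialPotential - fLow)) := by gcongr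
    _ = _ := by field_simp

theorem average_iter_sub (h : M.Admissible G fLow) (t r : ℕ) :
    average (M.iter t r).x - average (M.iter t 0).x
      = ∑ q ∈ Finset.range r, (1 / 2 : ℝ) • average (M.displacement t q) := by
  rw [← Finset.sum_range_sub fun q => average (M.iter t q).x]
  refine Finset.sum_congr rfl fun q _ => ?_
  rw [iter_succ, stageStep, average_innerStep_x h.weights, add_sub_cancel_left]
  rfl

/-- A stage in which some proximal point reaches the boundary of the feasible set decreases the
potential by a multiple of the squared increment of the radius. -/
theorem le_sum_decrease_of_boundary (h : M.Admissible G fLow) {t : ℕ} (ht : 1 ≤ t) {r : ℕ}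
    (hr : r < M.R t) {i : Fin N}
    (hi : M.v t ≤ ‖proxStep (M.X t) (M.α t) ((M.iter t r).y i) ((M.iter t r).x i)
      - average M.x₀‖) :
    M.ε / 12 * (M.v t - M.v (t - 1)) ^ 2 ≤ ∑ q ∈ Finset.range (M.R t), M.decrease t q := by
  have hN := h.N_pos
  have hN1 := h.one_le_N
  have hκ := h.κ_pos
  have hκ' := h.κ'_pos
  have hα := h.α_pos t
  have hε := h.ε_pos
  have hε2 := h.ε_lt_two
  have hm := h.ten_mul_le_one_div_α t
  set m := 1 / M.α t with hmdef
  have hc := h.trackingWeight_pos t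
  set a : Vec K := average (M.iter t r).x - average (M.iter t 0).x with ha
  set b : Vec K := (M.iter t r).x i - average (M.iter t r).x with hb
  set d : Vec K := M.displacement t r i with hd
  -- From the initial average of the stage to the boundary point: drift `a` of the average,
  -- deviation `b` of agent `i`, last displacement `d`.
  have htri : M.v t - M.v (t - 1) ≤ ‖a‖ + ‖b‖ + ‖d‖ := by
    obtain ⟨t, rfl⟩ := Nat.exists_eq_add_of_le' ht
    have h0 : average (M.iter (t + 1) 0).x ∈ M.X t := (h.afterStages_inv t).2.1
    rw [Input.X, mem_closedBall_iff_norm] at h0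
    have h1 : proxStep (M.X (t + 1)) (M.α (t + 1)) ((M.iter (t + 1) r).y i)
        ((M.iter (t + 1) r).x i) - average M.x₀
        = a + b + d + (average (M.iter (t + 1) 0).x - average M.x₀) := by
      rw [ha, hb, hd, displacement, direction]
      abel
    rw [h1] at hi
    have h2 := norm_add_le (a + b + d) (average (M.iter (t + 1) 0).x - average M.x₀)
    have h3 := norm_add₃_le (a := a) (b := b) (c := d)
    rw [Nat.add_sub_cancel]
    linarith
  have hΔ : (M.v t - M.v (t - 1)) ^ 2 ≤ 3 * (‖a‖ ^ 2 + ‖b‖ ^ 2 + ‖d‖ ^ 2) := by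
    have h0 : 0 ≤ M.v t - M.v (t - 1) := sub_nonneg.2 (h.v_mono (Nat.sub_le _ _))
    have h1 := pow_le_pow_left₀ h0 htri 2
    nlinarith [sq_nonneg (‖a‖ - ‖b‖), sq_nonneg (‖b‖ - ‖d‖), sq_nonneg (‖a‖ - ‖d‖)]
  -- The ceiling adds less than one iteration, so `ε r ≤ m + ε`, and `ε < 2 ≤ m`.
  have hrm : M.ε * r ≤ 2 * m := by
    have h1 : (M.R t : ℝ) < 1 / (M.ε * M.α t) + 1 :=
      Nat.ceil_lt_add_one (h.one_div_ε_mul_α_pos t).le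
    have h2 : M.ε * (1 / (M.ε * M.α t)) = m := by
      rw [hmdef]
      field_simp
    have h3 : (r : ℝ) ≤ M.R t := by exact_mod_cast hr.le
    nlinarith
  -- Cauchy–Schwarz over `r` steps loses a factor `r`, which `ε r ≤ 2 m` absorbs.
  have hA : M.ε / 4 * ‖a‖ ^ 2 ≤ ∑ q ∈ Finset.range r, M.decrease t q := by
    have h1 : ‖a‖ ^ 2 ≤ r * (1 / 4 * (1 / N)
        * ∑ q ∈ Finset.range r, stackedSq (M.displacement t q)) := by
      rw [ha, h.average_iter_sub]
      refine (norm_sum_sq_le _ _).trans ?_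
      rw [Finset.card_range]
      refine mul_le_mul_of_nonneg_left ?_ (Nat.cast_nonneg r)
      rw [Finset.mul_sum]
      refine Finset.sum_le_sum fun q _ => ?_
      rw [norm_smul, mul_pow]
      have := norm_average_sq_le h.agents (M.displacement t q)
      rw [mul_assoc, one_div_mul_eq_div (N : ℝ)]
      have h2 : ‖average (M.displacement t q)‖ ^ 2 ≤ stackedSq (M.displacement t q) / N := by
        rwa [le_div_iff₀' hN]
      norm_num
      linarith
    have h2 : ∑ q ∈ Finset.range r, 1 / (8 * N) * m * stackedSq (M.displacement t q)
        ≤ ∑ q ∈ Finset.range r, M.decrease t q := by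
      refine Finset.sum_le_sum fun q _ => ?_
      have h2 := consensusSq_nonneg (M.iter t q).x
      have h3 := consensusSq_nonneg (M.iter t q).y
      have h4 : 0 ≤ (1 - (1 + M.γ) * M.η ^ 2) / 2 * consensusSq (M.iter t q).x := by positivity
      have h5 : 0 ≤ M.trackingWeight t * (1 - (1 + M.ξ) * M.η ^ 2) / 2
        * consensusSq (M.iter t q).y := by positivity
      unfold decrease
      linarith
    rw [← Finset.mul_sum] at h2
    refine le_trans ?_ h2
    have hS : 0 ≤ ∑ q ∈ Finset.range r, stackedSq (M.displacement t q) :=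
      Finset.sum_nonneg fun q _ => stackedSq_nonneg _
    set S := ∑ q ∈ Finset.range r, stackedSq (M.displacement t q)
    calc M.ε / 4 * ‖a‖ ^ 2 ≤ M.ε / 4 * (r * (1 / 4 * (1 / N) * S)) := by gcongr
      _ = M.ε * r * (1 / 16 * (1 / N) * S) := by ring
      _ ≤ 2 * m * (1 / 16 * (1 / N) * S) := by gcongr
      _ = _ := by field_simp; ring
  -- These two are charged to iteration `r` itself, disjoint from the iterations that pay for `a`.
  -- The bound for `b` is where `ε < 2 κ` enters.
  have hBD : M.ε / 4 * (‖b‖ ^ 2 + ‖d‖ ^ 2) ≤ M.decrease t r := by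
    have h1 : ‖b‖ ^ 2 ≤ consensusSq (M.iter t r).x := by
      rw [hb, consensusSq]
      exact norm_sq_le_stackedSq (fun i => (M.iter t r).x i - average (M.iter t r).x) i
    have h2 : ‖d‖ ^ 2 ≤ stackedSq (M.displacement t r) := by
      rw [hd]
      exact norm_sq_le_stackedSq (M.displacement t r) i
    have h3 := consensusSq_nonneg (M.iter t r).y
    have h4 : 0 ≤ M.trackingWeight t * (1 - (1 + M.ξ) * M.η ^ 2) / 2
      * consensusSq (M.iter t r).y := by positivity
    have h5 : M.ε / 4 * ‖b‖ ^ 2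
        ≤ (1 - (1 + M.γ) * M.η ^ 2) / 2 * consensusSq (M.iter t r).x := by
      have := h.ε_lt
      exact mul_le_mul (by linarith) h1 (sq_nonneg _) (by positivity)
    have h6 : M.ε / 4 * ‖d‖ ^ 2 ≤ 1 / (8 * N) * m * stackedSq (M.displacement t r) := by
      gcongr
      rw [one_div_mul_eq_div, le_div_iff₀ (by positivity)]
      nlinarith
    unfold decrease
    linarith
  calc M.ε / 12 * (M.v t - M.v (t - 1)) ^ 2
      ≤ M.ε / 12 * (3 * (‖a‖ ^ 2 + ‖b‖ ^ 2 + ‖d‖ ^ 2)) := by gcongr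
    _ = M.ε / 4 * ‖a‖ ^ 2 + M.ε / 4 * (‖b‖ ^ 2 + ‖d‖ ^ 2) := by ring
    _ ≤ ∑ q ∈ Finset.range (r + 1), M.decrease t q := by
        rw [Finset.sum_range_succ]
        exact add_le_add hA hBD
    _ ≤ _ := Finset.sum_le_sum_of_subset_of_nonneg (Finset.range_mono hr)
        fun q _ _ => h.decrease_nonneg t q

/-- The equation for the number of stages bounds the squared increments of the radii below. -/
theorem le_sum_radii_of_isStageNumber (h : M.Admissible G fLow) {T : ℕ}
    (hT : M.IsStageNumber fLow T) :
    128 * (M.initialPotential - fLow)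
      ≤ M.ε * ∑ t ∈ Finset.Icc 1 T, (M.v t - M.v (t - 1)) ^ 2 := by
  obtain ⟨hT0, hTeq⟩ := hT
  have hT0' : (0 : ℝ) < T := by exact_mod_cast hT0
  have hε := h.ε_pos
  set S := ∑ t ∈ Finset.Icc 1 T, (M.v t - M.v (t - 1)) ^ 2 with hS
  have hS0 : 0 < S := by
    -- If all increments vanished, division by zero would give the value 0 and hence `T = 0`.
    refine (Finset.sum_nonneg fun _ _ => sq_nonneg _).lt_of_ne fun h0 => ?_
    rw [hS, ← h0] at hTeq
    simp at hTeq
    omega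
  have h1 : 1 / M.ε * (128 * (M.initialPotential - fLow) / (1 / (T : ℝ) * S)) ≤ T := by
    conv_rhs => rw [hTeq]
    exact Nat.le_ceil _
  have h2 : 1 / M.ε * (128 * (M.initialPotential - fLow) / (1 / (T : ℝ) * S))
      = T * (128 * (M.initialPotential - fLow) / (M.ε * S)) := by
    field_simp
  rw [h2] at h1
  have h3 : 128 * (M.initialPotential - fLow) / (M.ε * S) ≤ 1 :=
    le_of_mul_le_mul_left (by linarith) hT0'
  rwa [div_le_one (by positivity)] at h3

theorem exists_avgGap_le (h : M.Admissible G fLow) {T : ℕ} (hT : M.IsStageNumber fLow T) :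
    ∃ t ∈ Finset.Icc 1 T, M.avgGap t ≤ M.gapConst * (M.initialPotential - fLow) * M.ε := by
  by_contra! hcon
  have hP : 0 < M.initialPotential - fLow := sub_pos.2 (h.lt_potential _ _ _)
  have h1 : ∑ t ∈ Finset.Icc 1 T, M.ε / 12 * (M.v t - M.v (t - 1)) ^ 2
      ≤ ∑ t ∈ Finset.Icc 1 T, ∑ q ∈ Finset.range (M.R t), M.decrease t q := by
    refine Finset.sum_le_sum fun t ht => ?_
    have ht1 := (Finset.mem_Icc.1 ht).1
    by_contra hlt
    refine (hcon t ht).not_ge (h.avgGap_le_of_interior ht1 fun r hr i => ?_)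
    by_contra hge
    exact hlt (h.le_sum_decrease_of_boundary ht1 hr (not_lt.1 hge))
  rw [← Finset.mul_sum] at h1
  -- The contradiction is `128 / 12 > 1`.
  linarith [h.sum_decrease_lt T, h.le_sum_radii_of_isStageNumber hT]

end Admissible

end Input

end Magenta

end

theorem theorem3 {N K : ℕ} (hN : 0 < N) (G : SimpleGraph (Fin N))
    (M : Magenta.Input N K) (fLow : ℝ)
    (hprob : Magenta.ProblemAssumption M.f M.Lip fLow)
    (hW : Magenta.WeightAssumption G M.W)
    (hγ : 0 < M.γ) (hξ : 0 < M.ξ)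
    (hγη : (1 + M.γ) * M.η ^ 2 < 1) (hξη : (1 + M.ξ) * M.η ^ 2 < 1)
    (hv₀ : 0 ≤ M.v 0) (hv : Monotone M.v) (hx₀ : ∀ i, M.x₀ i ∈ M.X 1)
    (hε : 0 < M.ε) (hε' : M.ε < 2 * (1 - (1 + M.γ) * M.η ^ 2))
    (T : ℕ) (hT : M.IsStageNumber fLow T) :
    -- an approximately stationary stage occurs among the stages `1, …, T`
    (∃ t ∈ Finset.Icc 1 T,
      M.avgGap t ≤ M.gapConst * (M.initialPotential - fLow) * M.ε) ∧
    -- number of rounds made in the stages `1, …, T`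
    (M.afterStages T).rounds = ∑ t ∈ Finset.Icc 1 T, ⌈1 / (M.ε * M.α t)⌉₊ ∧
    1 / M.ε * ∑ t ∈ Finset.Icc 1 T, 1 / M.α t ≤ ((M.afterStages T).rounds : ℝ) ∧
    ((M.afterStages T).rounds : ℝ) < 1 / M.ε * ∑ t ∈ Finset.Icc 1 T, 1 / M.α t + T ∧
    ((∀ t ∈ Finset.Icc 1 T, ∃ m : ℕ, 1 / (M.ε * M.α t) = m) →
      ((M.afterStages T).rounds : ℝ) = 1 / M.ε * ∑ t ∈ Finset.Icc 1 T, 1 / M.α t) ∧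
    -- explicit form of this number
    1 / M.ε * ∑ t ∈ Finset.Icc 1 T, 1 / M.α t =
      1 / M.ε * ∑ t ∈ Finset.Icc 1 T,
        max (max (4 * M.Lhat t + 8 * N / M.γ + 10 * N)
          (64 * (1 + 1 / M.ξ) * M.Lhat t ^ 2
            / (N * (1 - (1 + M.γ) * M.η ^ 2) * (1 - (1 + M.ξ) * M.η ^ 2)))) 1 := by
  have h : M.Admissible G fLow :=
    ⟨hN, hprob, hW, hγ, hξ, hγη, hξη, hv₀, hv, hx₀, hε, hε'⟩
  refine ⟨h.exists_avgGap_le hT, M.rounds_afterStages T, ?_, ?_, ?_, ?_⟩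
  · rw [M.sum_one_div, M.rounds_afterStages, Nat.cast_sum]
    exact Finset.sum_le_sum fun t _ => Nat.le_ceil _
  · have h1 : ∑ t ∈ Finset.Icc 1 T, (M.R t : ℝ)
        < ∑ t ∈ Finset.Icc 1 T, (1 / (M.ε * M.α t) + 1) :=
      Finset.sum_lt_sum_of_nonempty (Finset.nonempty_Icc.2 hT.1) fun t _ =>
        Nat.ceil_lt_add_one (h.one_div_ε_mul_α_pos t).le
    rw [M.sum_one_div, M.rounds_afterStages, Nat.cast_sum]
    simpa [Finset.sum_add_distrib] using h1
  · intro hint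
    rw [M.sum_one_div, M.rounds_afterStages, Nat.cast_sum]
    refine Finset.sum_congr rfl fun t ht => ?_
    obtain ⟨m, hm⟩ := hint t ht
    rw [Magenta.Input.R, hm, Nat.ceil_natCast]
  · simp only [h.one_div_α]
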